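/- A finite simplicial complex is a pair $S=(V,H)$ where $V$ is a finite nonempty set of vertices and $H\subseteq 2^V$ contains all singletons and is closed under taking subsets. The elements of $H$ are called faces. Write $\dim S=\max\{|X| : X\in H\}-1$. The restriction of $S$ to a nonempty $W\subseteq V$ is $S|_W=(W,H\cap 2^W)$; it is proper if $W\neq V$. A square boolean matrix is nonsingular if independent permutations of its rows and of its columns turn it into a lower triangular matrix with $1$'s on the diagonal. The complex $S$ is boolean representable if there is a boolean matrix $M$ with columns indexed by $V$ such that, for all $X\subseteq V$, $X\in H$ if and only if the submatrix $M[Y,X]$ is nonsingular for some set $Y$ of rows. The complex $S$ is a TBRSC if there are a boolean representable complex $(V,H')$ and $k\ge 1$ with $H=\{X\in H' : |X|\le k\}$. The complex $S$ is paving if every $X\subseteq V$ with $|X|=\dim S$ is a face. Let $\mathrm{BPav}(d)$ (respectively $\mathrm{TBPav}(d)$) be the class of paving complexes of dimension $d$ that are boolean representable (respectively TBRSCs). We call $S\in \mathrm{TBPav}(d)\setminus\mathrm{BPav}(d)$ minimal if every proper restriction of $S$ is boolean representable. **Lemma 6.3.** Let $d\ge 2$. Then the maximum number of vertices of a minimal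 $S\in\mathrm{TBPav}(d)\setminus\mathrm{BPav}(d)$ is $(d+1)(d+2)$. Moreover, this maximum is attained by the Swirl, defined as follows. Take $(d+1)(d+2)$ distinct vertices $a_i$ and $b_{ij}$ ($0\le i,j\le d$), and put $A_i=\{a_0,\dots,a_d\}\setminus\{a_i\}$ and $B_i=\{b_{i0},\dots,b_{id}\}$. Let $C_i$ consist of $B_i$ and all $(d+1)$-element subsets of $A_i\cup(B_i\setminus\{b_{i0}\})$. The faces of the Swirl are the sets of at most $d+1$ vertices that belong to none of $C_0,\dots,C_d$. The Swirl is a minimal member of $\mathrm{TBPav}(d)\setminus\mathrm{BPav}(d)$. -/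

import Mathlib

universe u

/-- A finite simplicial complex `(V, H)`: `V` is a finite nonempty set and `H ⊆ 2^V` contains all
singletons and is closed under taking subsets. In particular the empty set is a face (in contrast
to Mathlib's `AbstractSimplicialComplex`, whose faces are nonempty). -/
@[ext]
structure FinComplex (V : Type u) [Fintype V] where
  faces : Set (Finset V)
  nonempty_vertices : Nonempty V
  singleton_mem : ∀ v : V, {v} ∈ faces
  down_closed : ∀ X ∈ faces, ∀ Y, Y ⊆ X → Y ∈ faces

namespace FinComplex

variable {V : Type u} [Fintype V]

open Classical in
/-- The rank: the maximal number of elements of a face. -/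
noncomputable def rank (S : FinComplex V) : ℕ :=
  (Finset.univ.filter (fun X => X ∈ S.faces)).sup Finset.card

/-- The dimension `rank - 1`. The vertex set is nonempty and its singletons are faces, so the rank
is at least one and the subtraction never truncates. -/
noncomputable def dim (S : FinComplex V) : ℕ := S.rank - 1

/-- `S` is paving if all sets of `dim S` vertices are faces. -/
def IsPaving (S : FinComplex V) : Prop :=
  ∀ X : Finset V, X.card = S.dim → X ∈ S.faces

/-- The class `Pav(d)` of paving simplicial complexes of dimension `d`. -/
def IsPav (S : FinComplex V) (d : ℕ) : Prop := S.IsPaving ∧ S.dim = d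

/-- The restriction of `S` to a nonempty set `W` of vertices: `(W, H ∩ 2^W)`. -/
def restrict (S : FinComplex V) (W : Finset V) (hW : W.Nonempty) : FinComplex W where
  faces := {X | X.map (Function.Embedding.subtype _) ∈ S.faces}
  nonempty_vertices := hW.to_subtype
  singleton_mem v := by simpa using S.singleton_mem v
  down_closed X hX Y hYX := S.down_closed _ hX _ (Finset.map_subset_map.2 hYX)

/-- The `k`-truncation of `S`: the faces of `S` with at most `k` elements. -/
def truncate (S : FinComplex V) (k : ℕ) (hk : 1 ≤ k) : FinComplex V where
  faces := {X | X ∈ S.faces ∧ X.card ≤ k}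
  nonempty_vertices := S.nonempty_vertices
  singleton_mem v := ⟨S.singleton_mem v, by simpa using hk⟩
  down_closed X hX Y hYX :=
    ⟨S.down_closed X hX.1 Y hYX, (Finset.card_le_card hYX).trans hX.2⟩

end FinComplex

/-- Lower unitriangular boolean matrices: ones on the diagonal, zeros above it. -/
def IsLowerUnitriangular {k : ℕ} (M : Matrix (Fin k) (Fin k) Bool) : Prop :=
  (∀ i, M i i = true) ∧ ∀ i j, i < j → M i j = false

/-- A boolean matrix is nonsingular if some independent orderings of its rows and of its columns
make it a (square) lower unitriangular matrix. -/
def IsBoolNonsingular {R C : Type*} (M : Matrix R C Bool) : Prop :=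
  ∃ (k : ℕ) (e : Fin k ≃ R) (f : Fin k ≃ C), IsLowerUnitriangular (M.submatrix e f)

/-- A set `X` of columns of `M` is `M`-independent if `M[Y, X]` is nonsingular for some set `Y` of
rows. -/
def IsBoolIndependent {R C : Type*} (M : Matrix R C Bool) (X : Finset C) : Prop :=
  ∃ Y : Finset R,
    IsBoolNonsingular (M.submatrix (fun r : Y => (r : R)) (fun c : X => (c : C)))

namespace FinComplex

variable {V : Type u} [Fintype V]

/-- `S` is boolean representable (a BRSC): its faces are exactly the `M`-independent sets of
columns, for some boolean matrix `M` with columns indexed by the vertices. -/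
def IsBooleanRepresentable (S : FinComplex V) : Prop :=
  ∃ (m : ℕ) (M : Matrix (Fin m) V Bool), ∀ X : Finset V, X ∈ S.faces ↔ IsBoolIndependent M X

/-- `S` is a TBRSC: a truncation of a boolean representable complex. -/
def IsTBRSC (S : FinComplex V) : Prop :=
  ∃ (S' : FinComplex V) (k : ℕ) (hk : 1 ≤ k), S'.IsBooleanRepresentable ∧ S = S'.truncate k hk

/-- The class `BPav(d)`. -/
def IsBPav (S : FinComplex V) (d : ℕ) : Prop := S.IsPav d ∧ S.IsBooleanRepresentable

/-- The class `TBPav(d)`. -/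
def IsTBPav (S : FinComplex V) (d : ℕ) : Prop := S.IsPav d ∧ S.IsTBRSC

/-- `S` is a minimal member of `TBPav(d) \ BPav(d)`: all its restrictions to proper nonempty sets
of vertices are boolean representable. -/
def IsMinimalTBPavDiffBPav (S : FinComplex V) (d : ℕ) : Prop :=
  S.IsTBPav d ∧ ¬ S.IsBPav d ∧
    ∀ (W : Finset V) (hW : W.Nonempty), W ≠ Finset.univ →
      (S.restrict W hW).IsBooleanRepresentable

end FinComplex

namespace Swirl

/-- The vertices of the Swirl: `Sum.inl i` is `a_i` and `Sum.inr (i, j)` is `b_{ij}`,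
for `0 ≤ i, j ≤ d`. -/
abbrev Vertex (d : ℕ) : Type := Fin (d + 1) ⊕ (Fin (d + 1) × Fin (d + 1))

/-- `A_i = {a_0, …, a_d} \ {a_i}`. -/
def setA (d : ℕ) (i : Fin (d + 1)) : Set (Vertex d) := {v | ∃ j, j ≠ i ∧ v = Sum.inl j}

/-- `B_i = {b_{i0}, …, b_{id}}`. -/
def setB (d : ℕ) (i : Fin (d + 1)) : Set (Vertex d) := {v | ∃ j, v = Sum.inr (i, j)}

/-- `C_i = P_{d+1}(A_i ∪ (B_i \ {b_{i0}})) ∪ {B_i}`. -/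
def setC (d : ℕ) (i : Fin (d + 1)) : Set (Finset (Vertex d)) :=
  {X | X.card = d + 1 ∧ (X : Set (Vertex d)) ⊆ setA d i ∪ (setB d i \ {Sum.inr (i, 0)})} ∪
    {X | (X : Set (Vertex d)) = setB d i}

theorem card_of_mem_setC {d : ℕ} {i : Fin (d + 1)} {X : Finset (Vertex d)}
    (hX : X ∈ setC d i) : X.card = d + 1 := by
  rcases hX with hX | hX
  · exact hX.1
  · have h : X = Finset.univ.image (fun j : Fin (d + 1) => (Sum.inr (i, j) : Vertex d)) := by
      apply Finset.coe_injective
      rw [hX]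
      ext v
      simp [setB, eq_comm]
    rw [h, Finset.card_image_of_injective]
    · simp
    · intro a b hab
      simpa using hab

/-- The Swirl, for `d ≥ 2`: the faces are the sets of at most `d + 1` vertices that belong to
none of `C_0, …, C_d`. -/
def complex (d : ℕ) (hd : 2 ≤ d) : FinComplex (Vertex d) where
  faces := {X | X.card ≤ d + 1 ∧ ∀ i, X ∉ setC d i}
  nonempty_vertices := ⟨Sum.inl 0⟩
  singleton_mem v := by
    refine ⟨by simp, fun i hi => ?_⟩
    have := card_of_mem_setC hi
    rw [Finset.card_singleton] at this
    omega
  down_closed X hX Y hYX := by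
    refine ⟨(Finset.card_le_card hYX).trans hX.1, fun i hi => ?_⟩
    have h := card_of_mem_setC hi
    have : Y = X := Finset.eq_of_subset_of_card_le hYX (by rw [h]; exact hX.1)
    exact hX.2 i (this ▸ hi)

end Swirl

/-! A boolean matrix matters only through the zero sets of its rows: a set of columns is independent
iff it can be built one element at a time, each new element leaving a zero set that contains its
predecessors (`isBoolIndependent_iff_chainIndep`). Hence a paving complex of dimension `d` is
boolean representable iff each face with `d + 1` elements has all elements but one in a flat that
misses this one (`RepresentableOn.separates`, `representableOn_of_separates`).

Upper bound: if `S` is not representable, some such face `X` is not separated. For each `p ∈ X`, at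
most `d + 1` vertices suffice to force `p` into every flat containing `X \ {p}` (`exists_witness`).
`X` and these witnesses span at most `(d + 1) + (d + 1)^2` vertices and a non-representable
restriction, which by minimality is all of `S`.

The Swirl makes these witnesses disjoint: only `{a_0, …, a_d}` is hard to separate, and all of `B_i`
is needed to force `a_i` from `A_i`. -/

/-! ### Matrix independence in terms of closed sets -/

/-- `X` is independent with respect to a family `𝓕` of closed sets: its elements can be added one
by one, each of them outside a member of `𝓕` that contains all its predecessors. -/
inductive ChainIndep {V : Type*} [DecidableEq V] (𝓕 : Set (Finset V)) : Finset V → Prop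
  | empty : ChainIndep 𝓕 ∅
  | insert {X F : Finset V} {p : V} : F ∈ 𝓕 → X ⊆ F → p ∉ F → ChainIndep 𝓕 X →
      ChainIndep 𝓕 (insert p X)

namespace ChainIndep

theorem mono {V : Type*} [DecidableEq V] {𝓕 : Set (Finset V)} {X : Finset V}
    (hX : ChainIndep 𝓕 X) : ∀ Y ⊆ X, ChainIndep 𝓕 Y := by
  induction hX with
  | empty => intro Y hY; rw [Finset.subset_empty.1 hY]; exact .empty
  | @insert X F p hF hXF hp _ ih =>
    intro Y hY
    by_cases hpY : p ∈ Y
    · have h : Y.erase p ⊆ X := by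
        intro y hy
        rw [Finset.mem_erase] at hy
        exact Finset.mem_of_mem_insert_of_ne (hY hy.2) hy.1
      rw [← Finset.insert_erase hpY]
      exact .insert hF (h.trans hXF) hp (ih _ h)
    · refine ih Y fun y hy => Finset.mem_of_mem_insert_of_ne (hY hy) ?_
      rintro rfl
      exact hpY hy

theorem exists_separating {V : Type*} [DecidableEq V] {𝓕 : Set (Finset V)} {X : Finset V}
    (hX : ChainIndep 𝓕 X) (hne : X.Nonempty) :
    ∃ F ∈ 𝓕, ∃ p ∈ X, p ∉ F ∧ X.erase p ⊆ F := by
  cases hX with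
  | empty => simp at hne
  | @insert X F p hF hXF hp _ =>
    refine ⟨F, hF, p, Finset.mem_insert_self _ _, hp, ?_⟩
    rw [Finset.erase_insert fun h => hp (hXF h)]
    exact hXF

/-- Independence of the image under an embedding is independence with respect to the preimages
of the closed sets. -/
theorem map_iff {V W : Type*} [DecidableEq V] [DecidableEq W] (f : W ↪ V)
    {𝓕 : Set (Finset V)} {𝓖 : Set (Finset W)}
    (h₁ : ∀ G ∈ 𝓖, ∃ F ∈ 𝓕, ∀ x, x ∈ G ↔ f x ∈ F)
    (h₂ : ∀ F ∈ 𝓕, ∃ G ∈ 𝓖, ∀ x, x ∈ G ↔ f x ∈ F) (X : Finset W) :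
    ChainIndep 𝓕 (X.map f) ↔ ChainIndep 𝓖 X := by
  constructor
  · intro h
    generalize hY : X.map f = Y at h
    induction h generalizing X with
    | empty => rw [Finset.map_eq_empty.1 hY]; exact .empty
    | @insert Y F p hF hYF hp _ ih =>
      obtain ⟨x, hx, rfl⟩ := Finset.mem_map.1 (hY ▸ Finset.mem_insert_self p Y)
      obtain ⟨G, hG, hGF⟩ := h₂ F hF
      have hYx : (X.erase x).map f = Y := by
        rw [Finset.map_erase, hY, Finset.erase_insert fun h => hp (hYF h)]
      rw [← Finset.insert_erase hx]
      refine .insert hG (fun y hy => (hGF y).2 (hYF ?_)) (fun h => hp ((hGF x).1 h)) (ih _ hYx)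
      rw [← hYx]
      exact Finset.mem_map_of_mem f hy
  · intro h
    induction h with
    | empty => rw [Finset.map_empty]; exact .empty
    | @insert Y G p hG hYG hp _ ih =>
      obtain ⟨F, hF, hGF⟩ := h₁ G hG
      rw [Finset.map_insert]
      refine .insert hF (fun y hy => ?_) (fun h => hp ((hGF p).2 h)) ih
      obtain ⟨x, hx, rfl⟩ := Finset.mem_map.1 hy
      exact (hGF x).1 (hYG hx)

theorem of_card_le {V : Type*} [DecidableEq V] {d : ℕ} {𝓕 : Set (Finset V)}
    (h𝓕 : ∀ X, X.card < d → X ∈ 𝓕) (X : Finset V) (hX : X.card ≤ d) : ChainIndep 𝓕 X := by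
  induction X using Finset.induction_on with
  | empty => exact .empty
  | insert p X hp ih =>
    rw [Finset.card_insert_of_notMem hp] at hX
    exact .insert (h𝓕 X hX) subset_rfl hp (ih (by omega))

end ChainIndep

/-- Unitriangularity alone makes the rows and the columns distinct, so plain functions can replace
the bijections. -/
theorem isBoolIndependent_iff_exists_fin {R C : Type*} (M : Matrix R C Bool) (X : Finset C) :
    IsBoolIndependent M X ↔ ∃ (k : ℕ) (r : Fin k → R) (c : Fin k → C),
      IsLowerUnitriangular (M.submatrix r c) ∧ ∀ x, x ∈ X ↔ ∃ i, c i = x := by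
  classical
  constructor
  · rintro ⟨Y, k, e, f, h⟩
    refine ⟨k, fun i => e i, fun i => f i, h, fun x => ⟨fun hx => ?_, ?_⟩⟩
    · exact ⟨f.symm ⟨x, hx⟩, by simp⟩
    · rintro ⟨i, rfl⟩
      exact (f i).2
  · rintro ⟨k, r, c, h, hX⟩
    have hr : Function.Injective r := by
      intro i j hij
      by_contra hne
      rcases lt_or_gt_of_ne hne with hlt | hlt
      · have h1 := h.2 i j hlt
        have h2 := h.1 j
        simp_all
      · have h1 := h.2 j i hlt
        have h2 := h.1 i
        simp_all
    have hc : Function.Injective c := by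
      intro i j hij
      by_contra hne
      rcases lt_or_gt_of_ne hne with hlt | hlt
      · have h1 := h.2 i j hlt
        have h2 := h.1 i
        simp_all
      · have h1 := h.2 j i hlt
        have h2 := h.1 j
        simp_all
    refine ⟨Finset.univ.image r, k,
      Equiv.ofBijective (fun i => ⟨r i, Finset.mem_image_of_mem r (Finset.mem_univ i)⟩) ⟨?_, ?_⟩,
      Equiv.ofBijective (fun i => ⟨c i, (hX _).2 ⟨i, rfl⟩⟩) ⟨?_, ?_⟩, h⟩
    · intro i j hij
      exact hr (congrArg Subtype.val hij)
    · rintro ⟨y, hy⟩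
      obtain ⟨i, -, rfl⟩ := Finset.mem_image.1 hy
      exact ⟨i, rfl⟩
    · intro i j hij
      exact hc (congrArg Subtype.val hij)
    · rintro ⟨x, hx⟩
      obtain ⟨i, rfl⟩ := (hX x).1 hx
      exact ⟨i, rfl⟩

/-- Independence of columns is independence with respect to the zero sets of the rows. -/
theorem isBoolIndependent_iff_chainIndep {R C : Type*} [Fintype C] [DecidableEq C]
    (M : Matrix R C Bool) (X : Finset C) :
    IsBoolIndependent M X ↔
      ChainIndep (Set.range fun r => Finset.univ.filter fun c => M r c = false) X := by
  rw [isBoolIndependent_iff_exists_fin]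
  constructor
  · rintro ⟨k, r, c, h, hX⟩
    induction k generalizing X with
    | zero =>
      have : X = ∅ := Finset.eq_empty_of_forall_notMem fun x hx => by
        obtain ⟨i, -⟩ := (hX x).1 hx
        exact i.elim0
      rw [this]
      exact .empty
    | succ k ih =>
      have htail := ih (Finset.univ.image fun i : Fin k => c i.succ) (fun i => r i.succ)
        (fun i => c i.succ)
        ⟨fun i => h.1 i.succ, fun i j hij => h.2 _ _ (Fin.succ_lt_succ_iff.2 hij)⟩ (by simp)
      have hins : X = insert (c 0) (Finset.univ.image fun i : Fin k => c i.succ) := by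
        ext x
        simp [hX, Fin.exists_fin_succ, eq_comm]
      rw [hins]
      -- Row `r 0` has its only `1` in column `c 0`, so its zero set contains the other columns: `c
      -- 0` is the last element added.
      refine .insert ⟨r 0, rfl⟩ ?_ ?_ htail
      · intro x hx
        obtain ⟨i, -, rfl⟩ := Finset.mem_image.1 hx
        simpa using h.2 0 i.succ (Fin.succ_pos i)
      · have := h.1 0
        simp_all
  · intro h
    induction h with
    | empty => exact ⟨0, Fin.elim0, Fin.elim0, ⟨fun i => i.elim0, fun i => i.elim0⟩, by simp⟩
    | @insert X F p hF hXF hp _ ih =>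
      obtain ⟨r₀, rfl⟩ := hF
      obtain ⟨k, r, c, h, hX⟩ := ih
      refine ⟨k + 1, Fin.cons r₀ r, Fin.cons p c, ⟨fun i => ?_, fun i j hij => ?_⟩, fun x => ?_⟩
      · refine Fin.cases ?_ (fun i => ?_) i
        · simpa using hp
        · simpa using h.1 i
      · revert hij
        refine Fin.cases ?_ (fun j => ?_) j
        · intro hij
          exact absurd hij (Fin.not_lt_zero i)
        · refine Fin.cases (fun _ => ?_) (fun i hij => ?_) i
          · simpa using hXF ((hX _).2 ⟨j, rfl⟩)
          · simpa using h.2 i j (Fin.succ_lt_succ_iff.1 hij)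
      · simp [hX, Fin.exists_fin_succ, eq_comm]

/-- A family of subsets of a finite set is finite, so its members can serve as the zero sets of
finitely many rows. -/
theorem exists_matrix_isBoolIndependent_iff {V : Type*} [Fintype V] [DecidableEq V]
    (𝓕 : Set (Finset V)) :
    ∃ (m : ℕ) (M : Matrix (Fin m) V Bool), ∀ X, IsBoolIndependent M X ↔ ChainIndep 𝓕 X := by
  classical
  obtain ⟨m, ⟨e⟩⟩ := Finite.exists_equiv_fin 𝓕
  refine ⟨m, Matrix.of fun i v => decide (v ∉ (e.symm i : Finset V)), fun X => ?_⟩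
  rw [isBoolIndependent_iff_chainIndep]
  have : (Set.range fun r => Finset.univ.filter fun c =>
      Matrix.of (fun i v => decide (v ∉ (e.symm i : Finset V))) r c = false) = 𝓕 := by
    ext F
    constructor
    · rintro ⟨r, rfl⟩
      simp
    · intro hF
      exact ⟨e ⟨F, hF⟩, by simp⟩
  rw [this]

/-! ### Representability and flats -/

namespace FinComplex

variable {V : Type u} [Fintype V] [DecidableEq V]

/-- The restriction of `S` to `W` is represented by a family of closed sets. -/
def RepresentableOn (S : FinComplex V) (W : Finset V) : Prop :=
  ∃ 𝓕 : Set (Finset V), ∀ X ⊆ W, X ∈ S.faces ↔ ChainIndep 𝓕 X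

theorem isBooleanRepresentable_iff (S : FinComplex V) :
    S.IsBooleanRepresentable ↔ S.RepresentableOn Finset.univ := by
  constructor
  · rintro ⟨m, M, h⟩
    exact ⟨_, fun X _ => (h X).trans (isBoolIndependent_iff_chainIndep M X)⟩
  · rintro ⟨𝓕, h⟩
    obtain ⟨m, M, hM⟩ := exists_matrix_isBoolIndependent_iff 𝓕
    exact ⟨m, M, fun X => (h X (Finset.subset_univ X)).trans (hM X).symm⟩

theorem restrict_isBooleanRepresentable_iff (S : FinComplex V) (W : Finset V)
    (hW : W.Nonempty) :
    (S.restrict W hW).IsBooleanRepresentable ↔ S.RepresentableOn W := by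
  rw [isBooleanRepresentable_iff]
  constructor
  · rintro ⟨𝓖, h⟩
    refine ⟨(fun G => G.map (Function.Embedding.subtype _)) '' 𝓖, fun X hX => ?_⟩
    have hX' : (X.subtype (· ∈ W)).map (Function.Embedding.subtype _) = X := by
      rw [Finset.subtype_map, Finset.filter_true_of_mem fun x hx => hX hx]
    have := h (X.subtype (· ∈ W)) (Finset.subset_univ _)
    rw [← ChainIndep.map_iff (Function.Embedding.subtype _)
      (𝓕 := (fun G => G.map (Function.Embedding.subtype _)) '' 𝓖)] at this
    · change _ ∈ S.faces ↔ _ at this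
      rwa [hX'] at this
    · intro G hG
      exact ⟨_, ⟨G, hG, rfl⟩, by simp⟩
    · rintro _ ⟨G, hG, rfl⟩
      exact ⟨G, hG, by simp⟩
  · rintro ⟨𝓕, h⟩
    refine ⟨(fun F => F.subtype (· ∈ W)) '' 𝓕, fun X _ => ?_⟩
    rw [← ChainIndep.map_iff (Function.Embedding.subtype _) (𝓕 := 𝓕)]
    · refine h _ fun x hx => ?_
      obtain ⟨y, -, rfl⟩ := Finset.mem_map.1 hx
      exact y.2
    · rintro _ ⟨F, hF, rfl⟩
      exact ⟨F, hF, by simp⟩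
    · intro F hF
      exact ⟨_, ⟨F, hF, rfl⟩, by simp⟩

/-- `F` is a flat of the restriction of `S` to `W`. -/
def IsFlatOn (S : FinComplex V) (W F : Finset V) : Prop :=
  F ⊆ W ∧ ∀ X ∈ S.faces, X ⊆ F → ∀ p ∈ W, p ∉ F → insert p X ∈ S.faces

/-- Some member of a family contains all elements of `X` but one. -/
def Separates (P : Finset V → Prop) (X : Finset V) : Prop :=
  ∃ F, P F ∧ ∃ p ∈ X, p ∉ F ∧ X.erase p ⊆ F

/-- The closed set used at the last step of a chain, cut down to `W`, is a flat: a chain inside it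
can be extended by any vertex of `W` outside it. -/
theorem RepresentableOn.separates {S : FinComplex V} {W : Finset V} (h : S.RepresentableOn W)
    {X : Finset V} (hX : X ∈ S.faces) (hXW : X ⊆ W) (hne : X.Nonempty) :
    Separates (S.IsFlatOn W) X := by
  obtain ⟨𝓕, h⟩ := h
  obtain ⟨F, hF, p, hp, hpF, hXF⟩ := ((h X hXW).1 hX).exists_separating hne
  refine ⟨F ∩ W, ⟨Finset.inter_subset_right, fun Y hY hYF q hq hqF => ?_⟩, p, hp,
    fun h => hpF (Finset.mem_inter.1 h).1,
    Finset.subset_inter hXF ((Finset.erase_subset _ _).trans hXW)⟩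
  rw [Finset.subset_inter_iff] at hYF
  refine (h _ (Finset.insert_subset hq hYF.2)).2 (.insert hF hYF.1 (fun h => hqF ?_)
    ((h Y hYF.2).1 hY))
  exact Finset.mem_inter.2 ⟨h, hq⟩

/-- The family of all flats represents. Sets with fewer than `d` elements are themselves flats, so
up to size `d` chains come for free and only the last element of a facet needs a separating flat. -/
theorem representableOn_of_separates {S : FinComplex V} {W : Finset V} {d : ℕ}
    (hsmall : ∀ X : Finset V, X.card ≤ d → X ∈ S.faces)
    (hcard : ∀ X ∈ S.faces, X.card ≤ d + 1)
    (h : ∀ X ∈ S.faces, X ⊆ W → X.card = d + 1 → Separates (S.IsFlatOn W) X) :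
    S.RepresentableOn W := by
  have hchain : ∀ X : Finset V, X ⊆ W → X.card ≤ d → ChainIndep {F | S.IsFlatOn W F} X := by
    intro X
    induction X using Finset.induction_on with
    | empty => exact fun _ _ => .empty
    | insert p X hp ih =>
      intro hXW hX
      rw [Finset.card_insert_of_notMem hp] at hX
      rw [Finset.insert_subset_iff] at hXW
      refine .insert (F := X) ⟨hXW.2, fun Y _ hY q _ _ => hsmall _ ?_⟩ subset_rfl hp
        (ih hXW.2 (by omega))
      have := Finset.card_le_card hY
      have := Finset.card_insert_le q Y
      omega
  refine ⟨{F | S.IsFlatOn W F}, fun X hXW => ⟨fun hX => ?_, fun hX => ?_⟩⟩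
  · rcases (hcard X hX).lt_or_eq with hlt | heq
    · exact hchain X hXW (by omega)
    · obtain ⟨F, hF, p, hp, hpF, hXF⟩ := h X hX hXW heq
      rw [← Finset.insert_erase hp]
      refine .insert hF hXF hpF (hchain _ ((Finset.erase_subset _ _).trans hXW) ?_)
      rw [Finset.card_erase_of_mem hp]
      omega
  · induction hX with
    | empty => exact hsmall _ (by simp)
    | @insert X F p hF hXF hp _ ih =>
      rw [Finset.insert_subset_iff] at hXW
      exact hF.2 X (ih hXW.2) hXF p hXW.1 hp

/-- `F` is a flat as far as the addition of points to sets of at most `d` elements goes. -/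
def IsTruncFlat (S : FinComplex V) (d : ℕ) (F : Finset V) : Prop :=
  ∀ X : Finset V, X.card ≤ d → X ⊆ F → ∀ p ∉ F, insert p X ∈ S.faces

/-- The larger complex is the one generated by the truncated flats. Adding a point to a face of size
`d + 1` gives a set that truncation discards, so such faces impose no condition. -/
theorem isTBRSC_of_separates {S : FinComplex V} {d : ℕ} (hd : 1 ≤ d)
    (hsmall : ∀ X : Finset V, X.card ≤ d → X ∈ S.faces)
    (hcard : ∀ X ∈ S.faces, X.card ≤ d + 1)
    (h : ∀ X ∈ S.faces, X.card = d + 1 → Separates (S.IsTruncFlat d) X) :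
    S.IsTBRSC := by
  have hchain : ∀ X : Finset V, X.card ≤ d → ChainIndep {F | S.IsTruncFlat d F} X := by
    refine ChainIndep.of_card_le fun X hX Y _ hYX q _ => hsmall _ ?_
    have := Finset.card_le_card hYX
    have := Finset.card_insert_le q Y
    omega
  let S' : FinComplex V :=
    { faces := {X | ChainIndep {F | S.IsTruncFlat d F} X}
      nonempty_vertices := S.nonempty_vertices
      singleton_mem := fun v => hchain _ (by simpa using hd)
      down_closed := fun X hX Y hY => hX.mono Y hY }
  refine ⟨S', d + 1, by omega, (isBooleanRepresentable_iff S').2 ⟨_, fun X _ => Iff.rfl⟩, ?_⟩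
  ext X
  constructor
  · intro hX
    refine ⟨?_, hcard X hX⟩
    change ChainIndep {F | S.IsTruncFlat d F} X
    rcases (hcard X hX).lt_or_eq with hlt | heq
    · exact hchain X (by omega)
    · obtain ⟨F, hF, p, hp, hpF, hXF⟩ := h X hX heq
      rw [← Finset.insert_erase hp]
      refine .insert hF hXF hpF (hchain _ ?_)
      rw [Finset.card_erase_of_mem hp]
      omega
  · rintro ⟨hX, hXd⟩
    change ChainIndep {F | S.IsTruncFlat d F} X at hX
    cases hX with
    | empty => exact hsmall _ (by simp)
    | @insert X F p hF hXF hp _ =>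
      rw [Finset.card_insert_of_notMem fun h => hp (hXF h)] at hXd
      exact hF X (by omega) hXF p hp

end FinComplex

/-! ### Paving complexes and the upper bound -/

namespace FinComplex

theorem rank_le_iff {V : Type*} [Fintype V] (S : FinComplex V) {n : ℕ} :
    S.rank ≤ n ↔ ∀ X ∈ S.faces, X.card ≤ n := by
  simp [rank, Finset.sup_le_iff]

theorem card_le_rank {V : Type*} [Fintype V] {S : FinComplex V} {X : Finset V}
    (hX : X ∈ S.faces) : X.card ≤ S.rank :=
  S.rank_le_iff.1 le_rfl X hX

theorem one_le_rank {V : Type*} [Fintype V] (S : FinComplex V) : 1 ≤ S.rank := by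
  obtain ⟨v⟩ := S.nonempty_vertices
  simpa using card_le_rank (S.singleton_mem v)

theorem isPav_iff {V : Type*} [Fintype V] {S : FinComplex V} {d : ℕ} :
    S.IsPav d ↔ (∀ X : Finset V, X.card ≤ d → X ∈ S.faces) ∧
      (∀ X ∈ S.faces, X.card ≤ d + 1) ∧ ∃ X ∈ S.faces, X.card = d + 1 := by
  classical
  constructor
  · rintro ⟨hpav, hdim⟩
    have hrank : S.rank = d + 1 := by
      have := S.one_le_rank
      unfold dim at hdim
      omega
    have hle : ∀ X ∈ S.faces, X.card ≤ d + 1 := S.rank_le_iff.1 hrank.le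
    obtain ⟨X, hX, hXd⟩ : ∃ X ∈ S.faces, X.card = d + 1 := by
      by_contra! hne
      have : S.rank ≤ d := S.rank_le_iff.2 fun X hX => by
        have := hle X hX
        have := hne X hX
        omega
      omega
    refine ⟨fun Y hY => ?_, hle, X, hX, hXd⟩
    have hV : d ≤ (Finset.univ : Finset V).card := by
      have := Finset.card_le_univ X
      rw [Finset.card_univ]
      omega
    obtain ⟨Z, hYZ, -, hZ⟩ := Finset.exists_subsuperset_card_eq (Finset.subset_univ Y) hY hV
    exact S.down_closed Z (hpav Z (hZ.trans hdim.symm)) Y hYZ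
  · rintro ⟨hsmall, hle, X, hX, hXd⟩
    have hdim : S.dim = d := by
      have h1 : S.rank ≤ d + 1 := S.rank_le_iff.2 hle
      have h2 := card_le_rank hX
      unfold dim
      omega
    exact ⟨fun Y hY => hsmall Y (hY.trans hdim).le, hdim⟩

/-- If no flat contains all elements of the facet `X` but `p`, this is already visible after
adding at most `d + 1` vertices. -/
theorem exists_witness {V : Type*} [Fintype V] [DecidableEq V] {S : FinComplex V} {d : ℕ}
    (hcard : ∀ X ∈ S.faces, X.card ≤ d + 1) {X : Finset V} (hX : X ∈ S.faces)
    (hXd : X.card = d + 1) (hsep : ¬ Separates (S.IsFlatOn Finset.univ) X) {p : V}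
    (hp : p ∈ X) :
    ∃ U : Finset V, U.card ≤ d + 1 ∧ ∀ W F : Finset V, U ⊆ W → X ⊆ W → S.IsFlatOn W F →
      X.erase p ⊆ F → p ∈ F := by
  set A := X.erase p with hA
  have hpA : p ∉ A := Finset.notMem_erase p X
  have hAcard : A.card = d := by
    rw [hA, Finset.card_erase_of_mem hp]
    omega
  have hAface : A ∈ S.faces := S.down_closed X hX A (Finset.erase_subset _ _)
  have hXA : insert p A = X := Finset.insert_erase hp
  classical
  -- One step of closing `A`: a flat containing `A` must contain `C`. As `p ∉ C`, `C` cannot be a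
  -- flat, or it would separate `X`.
  let C : Finset V := Finset.univ.filter fun q => q ∈ A ∨ insert q A ∉ S.faces
  have hmemC : ∀ q, q ∈ C ↔ q ∈ A ∨ insert q A ∉ S.faces := fun q => by simp [C]
  have hpC : p ∉ C := by
    rw [hmemC, hXA]
    exact fun h => h.elim hpA fun h => h hX
  have hAC : A ⊆ C := fun q hq => (hmemC q).2 (Or.inl hq)
  have hCF : ∀ W F Y : Finset V, Y ⊆ W → Y ⊆ C → S.IsFlatOn W F → A ⊆ F → Y ⊆ F := by
    intro W F Y hYW hYC hF hAF y hy
    by_contra hyF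
    rcases (hmemC y).1 (hYC hy) with h | h
    · exact hyF (hAF h)
    · exact h (hF.2 A hAface hAF y (hYW hy) hyF)
  have hflat : ¬ S.IsFlatOn Finset.univ C := fun h => hsep ⟨C, h, p, hp, hpC, hAC⟩
  obtain ⟨Y, hY, hYC, q, hqC, hqY⟩ :
      ∃ Y ∈ S.faces, Y ⊆ C ∧ ∃ q, q ∉ C ∧ insert q Y ∉ S.faces := by
    by_contra! h
    exact hflat ⟨Finset.subset_univ _, fun Y hY hYC q _ hq => h Y hY hYC q hq⟩
  rcases (hcard Y hY).lt_or_eq with hlt | heq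
  -- If `|Y| ≤ d`, the flat also swallows `q`, hence the face `A ∪ {q}` of maximal size `d + 1`, and
  -- can then miss no vertex.
  · refine ⟨insert q Y, (Finset.card_insert_le q Y).trans hlt, fun W F hU hXW hF hAF => ?_⟩
    by_contra hpF
    rw [Finset.insert_subset_iff] at hU
    have hYF := hCF W F Y hU.2 hYC hF hAF
    have hqF : q ∈ F := by
      by_contra hqF
      exact hqY (hF.2 Y hY hYF q hU.1 hqF)
    rw [hmemC, not_or, not_not] at hqC
    have hface := hF.2 _ hqC.2 (Finset.insert_subset hqF hAF) p (hXW hp) hpF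
    have hle := hcard _ hface
    rw [Finset.card_insert_of_notMem, Finset.card_insert_of_notMem hqC.1] at hle
    · omega
    · rw [Finset.mem_insert, not_or]
      refine ⟨?_, hpA⟩
      rintro rfl
      exact hpF hqF
  -- Here `Y` is already a face of maximal size inside the flat. Dropping `q` keeps the bound `d +
  -- 1`.
  · refine ⟨Y, heq.le, fun W F hU hXW hF hAF => ?_⟩
    by_contra hpF
    have hle := hcard _ (hF.2 Y hY (hCF W F Y hU hYC hF hAF) p (hXW hp) hpF)
    rw [Finset.card_insert_of_notMem fun h => hpC (hYC h)] at hle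
    omega

theorem IsMinimalTBPavDiffBPav.card_le {V : Type*} [Fintype V] {S : FinComplex V} {d : ℕ}
    (hS : S.IsMinimalTBPavDiffBPav d) : Fintype.card V ≤ (d + 1) * (d + 2) := by
  classical
  obtain ⟨⟨hpav, -⟩, hB, hmin⟩ := hS
  obtain ⟨hsmall, hcard, -⟩ := isPav_iff.1 hpav
  have hnot : ¬ S.RepresentableOn Finset.univ := fun h =>
    hB ⟨hpav, S.isBooleanRepresentable_iff.2 h⟩
  obtain ⟨X, hX, hXd, hsep⟩ : ∃ X ∈ S.faces, X.card = d + 1 ∧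
      ¬ Separates (S.IsFlatOn Finset.univ) X := by
    by_contra! h
    exact hnot (representableOn_of_separates hsmall hcard fun X hX _ hXd => h X hX hXd)
  have hw : ∀ p : V, ∃ U : Finset V, p ∈ X → U.card ≤ d + 1 ∧ ∀ W F : Finset V, U ⊆ W → X ⊆ W →
      S.IsFlatOn W F → X.erase p ⊆ F → p ∈ F := by
    intro p
    by_cases hp : p ∈ X
    · obtain ⟨U, hU⟩ := exists_witness hcard hX hXd hsep hp
      exact ⟨U, fun _ => hU⟩
    · exact ⟨∅, fun h => absurd h hp⟩
  choose U hU using hw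
  have hne : X.Nonempty := by
    rw [← Finset.card_pos]
    omega
  set W := X ∪ X.biUnion U with hWdef
  have hXW : X ⊆ W := Finset.subset_union_left
  have hWcard : W.card ≤ (d + 1) * (d + 2) := by
    calc W.card ≤ X.card + (X.biUnion U).card := Finset.card_union_le _ _
      _ ≤ X.card + X.card * (d + 1) := by
        gcongr
        exact Finset.card_biUnion_le_card_mul _ _ _ fun p hp => (hU p hp).1
      _ = (d + 1) * (d + 2) := by rw [hXd]; ring
  have hWuniv : W = Finset.univ := by
    by_contra h
    have hrep := (S.restrict_isBooleanRepresentable_iff W (hne.mono hXW)).1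
      (hmin W (hne.mono hXW) h)
    obtain ⟨F, hF, p, hp, hpF, hXF⟩ := hrep.separates hX hXW hne
    exact hpF ((hU p hp).2 W F
      ((Finset.subset_biUnion_of_mem U hp).trans Finset.subset_union_right) hXW hF hXF)
  rwa [hWuniv, Finset.card_univ] at hWcard

/-! ### Transport along a bijection -/

/-- The complex on `V` isomorphic to `S` by `e`. -/
def comap {V W : Type*} [Fintype V] [Fintype W] (e : V ≃ W) (S : FinComplex W) :
    FinComplex V where
  faces := {X | X.map e.toEmbedding ∈ S.faces}
  nonempty_vertices := e.nonempty_congr.2 S.nonempty_vertices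
  singleton_mem v := by simpa using S.singleton_mem (e v)
  down_closed X hX Y hYX := S.down_closed _ hX _ (Finset.map_subset_map.2 hYX)

section comap

variable {V W : Type*} [Fintype V] [Fintype W] (e : V ≃ W) {S : FinComplex W} {d : ℕ}

theorem mem_comap_faces {X : Finset V} :
    X ∈ (S.comap e).faces ↔ X.map e.toEmbedding ∈ S.faces := Iff.rfl

theorem comap_symm_comap : (S.comap e).comap e.symm = S := by
  ext X
  simp [mem_comap_faces, Finset.map_map]

theorem RepresentableOn.comap [DecidableEq V] [DecidableEq W] {U : Finset V}
    (h : S.RepresentableOn (U.map e.toEmbedding)) : (S.comap e).RepresentableOn U := by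
  obtain ⟨𝓕, h⟩ := h
  refine ⟨(fun F => F.map e.symm.toEmbedding) '' 𝓕, fun X hX => ?_⟩
  rw [← ChainIndep.map_iff e.toEmbedding (𝓕 := 𝓕)]
  · exact h _ (Finset.map_subset_map.2 hX)
  · rintro _ ⟨F, hF, rfl⟩
    exact ⟨F, hF, fun x => by simp [Finset.mem_map_equiv]⟩
  · intro F hF
    exact ⟨_, ⟨F, hF, rfl⟩, fun x => by simp [Finset.mem_map_equiv]⟩

theorem IsBooleanRepresentable.comap (h : S.IsBooleanRepresentable) :
    (S.comap e).IsBooleanRepresentable := by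
  classical
  rw [isBooleanRepresentable_iff] at h ⊢
  refine RepresentableOn.comap e ?_
  rwa [Finset.map_univ_equiv]

theorem IsPav.comap (h : S.IsPav d) : (S.comap e).IsPav d := by
  rw [isPav_iff] at h ⊢
  obtain ⟨hsmall, hcard, X, hX, hXd⟩ := h
  refine ⟨fun Y hY => hsmall _ (by simpa using hY), fun Y hY => by simpa using hcard _ hY,
    X.map e.symm.toEmbedding, ?_, by simpa using hXd⟩
  simpa [mem_comap_faces, Finset.map_map] using hX

theorem IsTBRSC.comap (h : S.IsTBRSC) : (S.comap e).IsTBRSC := by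
  obtain ⟨S', k, hk, hS', rfl⟩ := h
  refine ⟨S'.comap e, k, hk, hS'.comap e, ?_⟩
  ext X
  simp [mem_comap_faces, truncate]

theorem IsMinimalTBPavDiffBPav.comap (h : S.IsMinimalTBPavDiffBPav d) :
    (S.comap e).IsMinimalTBPavDiffBPav d := by
  classical
  obtain ⟨⟨hpav, htb⟩, hB, hmin⟩ := h
  refine ⟨⟨hpav.comap e, htb.comap e⟩, fun h => hB ⟨hpav, ?_⟩, fun U hU hne => ?_⟩
  · rw [← comap_symm_comap (S := S) e]
    exact h.2.comap e.symm
  · rw [restrict_isBooleanRepresentable_iff]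
    refine RepresentableOn.comap e ?_
    rw [← restrict_isBooleanRepresentable_iff _ _ (hU.map)]
    refine hmin _ _ fun h => hne ?_
    rwa [← Finset.map_univ_equiv e, Finset.map_inj] at h

end comap
end FinComplex
-- The Swirl
namespace Swirl

open FinComplex

variable {d : ℕ}

theorem inl_mem_of_mem_setC {i k : Fin (d + 1)} {X : Finset (Vertex d)} (hX : X ∈ setC d i)
    (hk : Sum.inl k ∈ X) :
    k ≠ i ∧ (X : Set (Vertex d)) ⊆ setA d i ∪ (setB d i \ {Sum.inr (i, 0)}) := by
  rcases hX with ⟨-, hX⟩ | hX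
  · refine ⟨?_, hX⟩
    have := hX (Finset.mem_coe.2 hk)
    simpa [setA, setB] using this
  · have : Sum.inl k ∈ setB d i := hX ▸ Finset.mem_coe.2 hk
    simp [setB] at this

theorem fst_eq_of_mem_setC {i k j : Fin (d + 1)} {X : Finset (Vertex d)} (hX : X ∈ setC d i)
    (hk : Sum.inr (k, j) ∈ X) : k = i := by
  rcases hX with ⟨-, hX⟩ | hX
  · have := hX (Finset.mem_coe.2 hk)
    simp [setA, setB] at this
    exact this.1
  · have : Sum.inr (k, j) ∈ setB d i := hX ▸ Finset.mem_coe.2 hk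
    simp [setB] at this
    exact this

theorem subset_of_mem_setC {i : Fin (d + 1)} {X : Finset (Vertex d)} (hX : X ∈ setC d i) :
    ∀ v ∈ X, v ∈ setA d i ∪ setB d i := by
  rintro (k | ⟨k, j⟩) hv
  · exact Or.inl ⟨k, (inl_mem_of_mem_setC hX hv).1, rfl⟩
  · rw [fst_eq_of_mem_setC hX hv]
    exact Or.inr ⟨j, rfl⟩

/-- A set of size `d` in `A_i ∪ B_i` is contained in no member of `C_k` for `k ≠ i`. -/
theorem insert_notMem_setC {i k : Fin (d + 1)} (hik : k ≠ i) {X : Finset (Vertex d)}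
    {p : Vertex d} (hX : ∀ v ∈ X, v ∈ setA d i ∪ setB d i) (hXd : X.card ≤ d) :
    insert p X ∉ setC d k := by
  intro h
  have hcard := card_of_mem_setC h
  have hle := Finset.card_insert_le p X
  -- `A_i ∪ B_i` and `A_k ∪ B_k` share only the `d - 1` vertices `a_m` with `m ≠ i, k`.
  have hsub : X ⊆ ((Finset.univ.erase i).erase k).image (Sum.inl : _ → Vertex d) := by
    rintro (m | ⟨m, j⟩) hv
    · have h1 := (inl_mem_of_mem_setC h (Finset.mem_insert_of_mem hv)).1
      have h2 := hX _ hv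
      simp [setA, setB] at h2
      simp [h1, h2]
    · have h1 := fst_eq_of_mem_setC h (Finset.mem_insert_of_mem hv)
      have h2 := hX _ hv
      simp [setA, setB] at h2
      exact absurd (h1.symm.trans h2) hik
  have h1 := (Finset.card_le_card hsub).trans Finset.card_image_le
  rw [Finset.card_erase_of_mem (by simp [hik]), Finset.card_erase_of_mem (by simp),
    Finset.card_univ, Fintype.card_fin] at h1
  -- For `d = 0` the subtraction in `h1` would truncate.
  have hd : d ≠ 0 := by
    rintro rfl
    exact hik (Subsingleton.elim (α := Fin 1) k i)
  omega

/-- The facet `{a_0, …, a_d}`. -/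
def core (d : ℕ) : Finset (Vertex d) := Finset.univ.image Sum.inl

theorem card_core : (core d).card = d + 1 := by
  rw [core, Finset.card_image_of_injective _ Sum.inl_injective, Finset.card_univ,
    Fintype.card_fin]

theorem core_mem_faces (hd : 2 ≤ d) : core d ∈ (complex d hd).faces :=
  ⟨card_core.le, fun i hi => (inl_mem_of_mem_setC hi (by simp [core] : Sum.inl i ∈ core d)).1 rfl⟩

theorem mem_faces_of_card_le (hd : 2 ≤ d) {X : Finset (Vertex d)} (hX : X.card ≤ d) :
    X ∈ (complex d hd).faces := by
  refine ⟨by omega, fun i hi => ?_⟩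
  have := card_of_mem_setC hi
  omega

theorem card_le_of_mem_faces (hd : 2 ≤ d) {X : Finset (Vertex d)}
    (hX : X ∈ (complex d hd).faces) : X.card ≤ d + 1 := hX.1

theorem isPav (hd : 2 ≤ d) : (complex d hd).IsPav d :=
  isPav_iff.2 ⟨fun _ => mem_faces_of_card_le hd, fun _ => card_le_of_mem_faces hd,
    core d, core_mem_faces hd, card_core⟩

/-- Every other facet contains two vertices that lie in no common member of a `C_i`. -/
theorem exists_pair (hd : 2 ≤ d) {X : Finset (Vertex d)} (hX : X ∈ (complex d hd).faces)
    (hXd : X.card = d + 1) (hne : X ≠ core d) :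
    ∃ x ∈ X, ∃ y ∈ X, ∀ i, ∀ Z ∈ setC d i, x ∈ Z → y ∉ Z := by
  -- Otherwise `X` contains some `b_{ij}` and so lies in `A_i ∪ B_i`. Not being in `C_i`, it
  -- contains both `b_{i0}` and some `a_k`; but no member of a `C_m` contains such a pair.
  by_contra! hpair
  obtain ⟨i, j, hij⟩ : ∃ i j, Sum.inr (i, j) ∈ X := by
    by_contra! h
    refine hne (Finset.eq_of_subset_of_card_le ?_ (by rw [card_core, hXd]))
    rintro (k | ⟨k, l⟩) hv
    · simp [core]
    · exact absurd hv (h k l)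
  have hsub : ∀ v ∈ X, v ∈ setA d i ∪ setB d i := by
    intro v hv
    obtain ⟨k, Z, hZ, h1, h2⟩ := hpair _ hij v hv
    rw [fst_eq_of_mem_setC hZ h1]
    exact subset_of_mem_setC hZ v h2
  have h0 : Sum.inr (i, 0) ∈ X := by
    by_contra h0
    refine hX.2 i (Or.inl ⟨hXd, fun v hv => ?_⟩)
    rcases hsub v hv with h | h
    · exact Or.inl h
    · refine Or.inr ⟨h, ?_⟩
      rintro rfl
      exact h0 hv
  obtain ⟨k, hk⟩ : ∃ k, Sum.inl k ∈ X := by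
    by_contra! h
    have hXB : X ⊆ Finset.univ.image fun j : Fin (d + 1) => (Sum.inr (i, j) : Vertex d) := by
      rintro (k | ⟨k, l⟩) hv
      · exact absurd hv (h k)
      · have := hsub _ hv
        simp [setA, setB] at this
        simp [this]
    have hXB' := Finset.eq_of_subset_of_card_le hXB
      (by rw [hXd]; exact Finset.card_image_le.trans (by simp))
    refine hX.2 i (Or.inr ?_)
    change (X : Set (Vertex d)) = setB d i
    rw [hXB']
    ext v
    simp [setB, eq_comm]
  obtain ⟨m, Z, hZ, h1, h2⟩ := hpair _ h0 _ hk
  have h3 := (inl_mem_of_mem_setC hZ h2).2 (Finset.mem_coe.2 h1)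
  rw [fst_eq_of_mem_setC hZ h1] at h3
  simp [setA, setB] at h3

/-- As `d ≥ 2`, there is a third element `p` besides the pair of `exists_pair`. The pair survives
its removal and keeps every `(X \ {p}) ∪ {q}` out of all `C_i`, so `X \ {p}` is a flat. -/
theorem exists_erase_insert_mem_faces (hd : 2 ≤ d) {X : Finset (Vertex d)}
    (hX : X ∈ (complex d hd).faces) (hXd : X.card = d + 1) (hne : X ≠ core d) :
    ∃ p ∈ X, ∀ Y ⊆ X.erase p, ∀ q, insert q Y ∈ (complex d hd).faces := by
  obtain ⟨x, hx, y, hy, hxy⟩ := exists_pair hd hX hXd hne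
  obtain ⟨p, hp, hpxy⟩ : ∃ p ∈ X, p ∉ ({x, y} : Finset (Vertex d)) := by
    by_contra! h
    have h1 : X.card ≤ _ := Finset.card_le_card h
    have h2 := Finset.card_le_two (a := x) (b := y)
    omega
  simp only [Finset.mem_insert, Finset.mem_singleton, not_or] at hpxy
  refine ⟨p, hp, fun Y hY q => ?_⟩
  have hsub : insert q Y ⊆ insert q (X.erase p) := Finset.insert_subset_insert q hY
  refine (complex d hd).down_closed (insert q (X.erase p)) ⟨?_, fun i hi => ?_⟩ _ hsub
  · refine (Finset.card_insert_le _ _).trans ?_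
    rw [Finset.card_erase_of_mem hp]
    omega
  · exact hxy i _ hi
      (Finset.mem_insert_of_mem (Finset.mem_erase.2 ⟨Ne.symm hpxy.1, hx⟩))
      (Finset.mem_insert_of_mem (Finset.mem_erase.2 ⟨Ne.symm hpxy.2, hy⟩))

theorem isTBRSC (hd : 2 ≤ d) : (complex d hd).IsTBRSC := by
  classical
  refine isTBRSC_of_separates (d := d) (by omega) (fun _ => mem_faces_of_card_le hd)
    (fun _ => card_le_of_mem_faces hd) fun X hX hXd => ?_
  by_cases hne : X = core d
  · subst hne
    -- `A_0 ∪ B_0` is only a truncated flat: it contains the face `A_0 ∪ {b_00}` of size `d + 1`.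
    refine ⟨Finset.univ.filter fun v => v ∈ setA d 0 ∪ setB d 0, ?_, Sum.inl 0, by simp [core],
      by simp [setA, setB], ?_⟩
    · intro Y hYd hY p hp
      refine ⟨(Finset.card_insert_le _ _).trans (by omega), fun k hk => ?_⟩
      by_cases hk0 : k = 0
      · subst hk0
        refine hp (Finset.mem_filter.2 ⟨Finset.mem_univ _, ?_⟩)
        exact subset_of_mem_setC hk p (Finset.mem_insert_self p Y)
      · exact insert_notMem_setC hk0 (fun v hv => (Finset.mem_filter.1 (hY hv)).2) hYd hk
    · rintro (k | v) hv
      · simpa [setA, setB] using Finset.ne_of_mem_erase hv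
      · simp [core] at hv
  · obtain ⟨p, hp, h⟩ := exists_erase_insert_mem_faces hd hX hXd hne
    exact ⟨X.erase p, fun Y _ hY q _ => h Y hY q, p, hp, Finset.notMem_erase p X, subset_rfl⟩

/-- A flat containing `A_i` absorbs each `b_{ij}` with `j ≠ 0`, then `b_{i0}` because `B_i` is not a
face. Now it contains the face `A_i ∪ {b_{i0}}` of maximal size, so it cannot miss `a_i`. -/
theorem not_isBooleanRepresentable (hd : 2 ≤ d) :
    ¬ (complex d hd).IsBooleanRepresentable := by
  intro h
  rw [isBooleanRepresentable_iff] at h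
  obtain ⟨F, hF, p, hp, hpF, hAF⟩ := h.separates (core_mem_faces hd) (Finset.subset_univ _)
    ⟨Sum.inl 0, by simp [core]⟩
  obtain ⟨i, -, rfl⟩ := Finset.mem_image.1 hp
  set A := (core d).erase (Sum.inl i) with hA
  have hAcard : A.card = d := by
    rw [hA, Finset.card_erase_of_mem hp, card_core]
    omega
  have hinr : ∀ v, Sum.inr v ∉ A := by simp [hA, core]
  have hmemA : ∀ v ∈ A, v ∈ setA d i := by
    rintro (k | v) hv
    · simpa [setA, hA, core] using hv
    · exact absurd hv (hinr v)
  have hB : ∀ j, j ≠ 0 → Sum.inr (i, j) ∈ F := by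
    intro j hj
    by_contra hjF
    have hface := hF.2 A (mem_faces_of_card_le hd hAcard.le) hAF _ (Finset.mem_univ _) hjF
    refine hface.2 i (Or.inl ⟨by rw [Finset.card_insert_of_notMem (hinr _), hAcard], ?_⟩)
    intro v hv
    rcases Finset.mem_insert.1 (Finset.mem_coe.1 hv) with rfl | hv
    · exact Or.inr (by simp [setB, hj])
    · exact Or.inl (hmemA v hv)
  have hB0 : Sum.inr (i, 0) ∈ F := by
    by_contra h0F
    let Y : Finset (Vertex d) := (Finset.univ.erase (0 : Fin (d + 1))).image
      fun j => Sum.inr (i, j)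
    have hYF : Y ⊆ F := by
      intro v hv
      obtain ⟨j, hj, rfl⟩ := Finset.mem_image.1 hv
      exact hB j (Finset.ne_of_mem_erase hj)
    have hYd : Y.card ≤ d := by
      refine Finset.card_image_le.trans ?_
      simp
    refine (hF.2 Y (mem_faces_of_card_le hd hYd) hYF _ (Finset.mem_univ _) h0F).2 i (Or.inr ?_)
    ext v
    constructor
    · intro hv
      rcases Finset.mem_insert.1 (Finset.mem_coe.1 hv) with rfl | hv
      · exact ⟨0, rfl⟩
      · obtain ⟨j, -, rfl⟩ := Finset.mem_image.1 hv
        exact ⟨j, rfl⟩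
    · rintro ⟨j, rfl⟩
      by_cases hj : j = 0
      · simp [hj]
      · exact Finset.mem_coe.2 (Finset.mem_insert_of_mem
          (Finset.mem_image_of_mem _ (Finset.mem_erase.2 ⟨hj, Finset.mem_univ _⟩)))
  have hface : insert (Sum.inr (i, 0)) A ∈ (complex d hd).faces := by
    refine ⟨(Finset.card_insert_le _ _).trans (by omega), fun k hk => ?_⟩
    have hki := fst_eq_of_mem_setC hk (Finset.mem_insert_self _ _)
    obtain ⟨v, hv⟩ : A.Nonempty := by
      rw [← Finset.card_pos]
      omega
    obtain ⟨m, -, rfl⟩ := hmemA v hv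
    have := (inl_mem_of_mem_setC hk (Finset.mem_insert_of_mem hv)).2
      (Finset.mem_coe.2 (Finset.mem_insert_self _ _))
    rw [hki] at this
    simp [setA, setB] at this
  have hle := card_le_of_mem_faces hd
    (hF.2 _ hface (Finset.insert_subset hB0 hAF) _ (Finset.mem_univ _) hpF)
  rw [Finset.card_insert_of_notMem, Finset.card_insert_of_notMem (hinr _)] at hle
  · omega
  · simp [hA]

theorem representableOn (hd : 2 ≤ d) {W : Finset (Vertex d)} (hW : W ≠ Finset.univ) :
    (complex d hd).RepresentableOn W := by
  classical
  refine representableOn_of_separates (d := d) (fun _ => mem_faces_of_card_le hd)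
    (fun _ => card_le_of_mem_faces hd) fun X hX hXW hXd => ?_
  by_cases hne : X = core d
  · subst hne
    obtain ⟨i, j, hij⟩ : ∃ i j, Sum.inr (i, j) ∉ W := by
      by_contra! h
      refine hW (Finset.eq_univ_iff_forall.2 ?_)
      rintro (k | ⟨k, l⟩)
      · exact hXW (by simp [core])
      · exact h k l
    -- All `(d + 1)`-subsets of this set are nonfaces, so its faces have at most `d` elements. The
    -- only other obstruction to being a flat is `B_i`, which is not inside `W`.
    refine ⟨W.filter fun v => v ∈ setA d i ∪ (setB d i \ {Sum.inr (i, 0)}),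
      ⟨Finset.filter_subset _ _, ?_⟩, Sum.inl i, by simp [core], by simp [setA, setB], ?_⟩
    · intro Y hY hYF p hpW hpF
      have hYD : (Y : Set (Vertex d)) ⊆ setA d i ∪ (setB d i \ {Sum.inr (i, 0)}) :=
        fun v hv => (Finset.mem_filter.1 (hYF hv)).2
      have hYd : Y.card ≤ d := by
        have h1 : Y.card ≠ d + 1 := fun h => hY.2 i (Or.inl ⟨h, hYD⟩)
        have h2 := card_le_of_mem_faces hd hY
        omega
      refine ⟨(Finset.card_insert_le _ _).trans (by omega), fun k hk => ?_⟩
      by_cases hki : k = i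
      · subst hki
        rcases hk with ⟨-, hk⟩ | hk
        · exact hpF (Finset.mem_filter.2 ⟨hpW, hk (by simp)⟩)
        · have : Sum.inr (k, j) ∈ ((insert p Y : Finset (Vertex d)) : Set (Vertex d)) :=
            hk ▸ ⟨j, rfl⟩
          rcases Finset.mem_insert.1 (Finset.mem_coe.1 this) with rfl | h
          · exact hij hpW
          · exact hij (Finset.mem_filter.1 (hYF h)).1
      · exact insert_notMem_setC hki
          (fun v hv => (hYD hv).imp_right fun h => h.1) hYd hk
    · rintro (k | v) hv
      · refine Finset.mem_filter.2 ⟨hXW (Finset.mem_of_mem_erase hv), Or.inl ?_⟩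
        simpa [setA] using Finset.ne_of_mem_erase hv
      · simp [core] at hv
  · obtain ⟨p, hp, h⟩ := exists_erase_insert_mem_faces hd hX hXd hne
    exact ⟨X.erase p, ⟨(Finset.erase_subset _ _).trans hXW, fun Y _ hY q _ _ => h Y hY q⟩,
      p, hp, Finset.notMem_erase p X, subset_rfl⟩

theorem isMinimalTBPavDiffBPav (hd : 2 ≤ d) : (complex d hd).IsMinimalTBPavDiffBPav d :=
  ⟨⟨isPav hd, isTBRSC hd⟩, fun h => not_isBooleanRepresentable hd h.2,
    fun W hW hne => ((complex d hd).restrict_isBooleanRepresentable_iff W hW).2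
      (representableOn hd hne)⟩

theorem card_vertex (d : ℕ) : Fintype.card (Vertex d) = (d + 1) * (d + 2) := by
  simp only [Fintype.card_sum, Fintype.card_prod, Fintype.card_fin]
  ring

end Swirl

theorem lemma6p3 (d : ℕ) (hd : 2 ≤ d) :
    IsGreatest
        {n : ℕ | ∃ (V : Type u) (_ : Fintype V) (S : FinComplex V),
          S.IsMinimalTBPavDiffBPav d ∧ Fintype.card V = n}
        ((d + 1) * (d + 2)) ∧
      (Swirl.complex d hd).IsMinimalTBPavDiffBPav d ∧
      Fintype.card (Swirl.Vertex d) = (d + 1) * (d + 2) := by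
  refine ⟨⟨?_, ?_⟩, Swirl.isMinimalTBPavDiffBPav hd, Swirl.card_vertex d⟩
  -- The Swirl lives in `Type`; a copy is needed in the universe `u`.
  · exact ⟨ULift.{u} (Swirl.Vertex d), inferInstance, (Swirl.complex d hd).comap Equiv.ulift,
      (Swirl.isMinimalTBPavDiffBPav hd).comap Equiv.ulift,
      (Fintype.card_ulift _).trans (Swirl.card_vertex d)⟩
  · rintro n ⟨V, _, S, hS, rfl⟩
    exact hS.card_le
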